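/- Let $n\ge 0$, $N\ge 1$ be integers, $\mathcal X\subseteq\{0,1\}^n$ a set of feasible solutions (for example $\mathcal X=\{\boldsymbol x\in\{0,1\}^n:\boldsymbol A\boldsymbol x\ge \boldsymbol b\}$), $\alpha\in(0,1]$, $\epsilon\ge 0$, and let $q,q'\in[1,\infty]$ satisfy $\frac1q+\frac1{q'}=1$. Let the support set be unrestricted, $\Xi=\mathbb R^n_+$, let $\hat{\boldsymbol\xi}_1,\dots,\hat{\boldsymbol\xi}_N\in\Xi$ be a sample and $\widehat{\mathbb P}^N=\frac1N\sum_{i=1}^N\delta_{\hat{\boldsymbol\xi}_i}$ its empirical distribution. For a probability distribution $\mathbb P$ on $\Xi$ put $$\mathrm{CVaR}^\alpha_{\mathbb P}[\tilde{\boldsymbol\xi}^T\boldsymbol x]=\inf_{t\in\mathbb R}\Big(t+\frac1\alpha\int_\Xi\max\{0,\boldsymbol\xi^T\boldsymbol x-t\}\,\mathbb P(\mathrm d\boldsymbol\xi)\Big).$$ Let $$\mathcal B_\epsilon(\widehat{\mathbb P}^N)=\Big\{\tfrac1N\sum_{i=1}^N\delta_{\boldsymbol\xi_i}:\ \boldsymbol\xi_i\in\Xi,\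 \sum_{i=1}^N\|\boldsymbol\xi_i-\hat{\boldsymbol\xi}_i\|_q\le N\epsilon\Big\},$$ and let $\textsc{Distr}\,\mathcal P$ be the problem $$\min_{\boldsymbol x\in\mathcal X}\ \max_{\mathbb P\in\mathcal B_\epsilon(\widehat{\mathbb P}^N)}\mathrm{CVaR}^\alpha_{\mathbb P}[\tilde{\boldsymbol\xi}^T\boldsymbol x].$$ Then, for every $\boldsymbol x\in\mathcal X$, the inner maximum is attained and equals $$\mathrm{CVaR}^\alpha_{\widehat{\mathbb P}^N}[\tilde{\boldsymbol\xi}^T\boldsymbol x]+\gamma\,\epsilon\,\|\boldsymbol x\|_{q'},\qquad \gamma=\begin{cases}N&\text{if }\alpha<\frac1N,\\ \frac1\alpha&\text{if }\alpha\ge\frac1N.\end{cases}$$ Consequently $\textsc{Distr}\,\mathcal P$ has the same optimal value and the same optimal solutions as the problem of minimizing $\mathrm{CVaR}^\alpha_{\widehat{\mathbb P}^N}[\tilde{\boldsymbol\xi}^T\boldsymbol x]+\gamma\epsilon\|\boldsymbol x\|_{q'}$ over $\boldsymbol x\in\mathcal X$. Moreover, if $\alpha\ge\frac1N$, all these assertions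 remain true when $\mathcal B_\epsilon(\widehat{\mathbb P}^N)$ is replaced by the whole Wasserstein ball $$\mathbb B_\epsilon(\widehat{\mathbb P}^N)=\{\mathbb Q\ \text{a probability distribution on}\ \Xi:\ d_W(\widehat{\mathbb P}^N,\mathbb Q)\le\epsilon\},$$ where $d_W(\mathbb Q_1,\mathbb Q_2)$ is the infimum of $\int\|\boldsymbol\xi_1-\boldsymbol\xi_2\|_q\,\Pi(\mathrm d\boldsymbol\xi_1,\mathrm d\boldsymbol\xi_2)$ over all joint probability distributions $\Pi$ with marginals $\mathbb Q_1,\mathbb Q_2$. -/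

import Mathlib

open scoped ENNReal

noncomputable section

namespace WRobust

/-- The `q`-norm `‖v‖_q = (∑ i, |v i| ^ q) ^ (1 / q)` on `ℝⁿ` (the maximum norm for `q = ∞`). -/
def qNorm {n : ℕ} (q : ℝ≥0∞) (v : Fin n → ℝ) : ℝ :=
  ‖(WithLp.toLp q v : PiLp q (fun _ : Fin n => ℝ))‖

/-- The nonnegative orthant `ℝⁿ₊`, i.e. the unrestricted support set. -/
def orthant (n : ℕ) : Set (Fin n → ℝ) := {ξ | ∀ i, 0 ≤ ξ i}

/-- The discrete distribution `(1 / N) ∑ i, δ_{ξ i}` given by a vector of `N` realizations. -/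
def empirical {n N : ℕ} (ξ : Fin N → Fin n → ℝ) : MeasureTheory.Measure (Fin n → ℝ) :=
  (N : ℝ≥0∞)⁻¹ • ∑ i, MeasureTheory.Measure.dirac (ξ i)

/-- Conditional Value at Risk at level `α` of the random cost `ξᵀ x`, with `ξ` distributed
according to `P`: the infimum over `t ∈ ℝ` of `t + (1 / α) E_P [ξᵀ x - t]₊`.
It takes values in the extended reals, and the expectation of the nonnegative function
`[ξᵀ x - t]₊` may be `+∞`. -/
def cvar {n : ℕ} (α : ℝ) (P : MeasureTheory.Measure (Fin n → ℝ)) (x : Fin n → ℝ) : EReal :=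
  ⨅ t : ℝ, (t : EReal) +
    ((ENNReal.ofReal (1 / α) * ∫⁻ ξ, ENNReal.ofReal (max 0 (ξ ⬝ᵥ x - t)) ∂P : ℝ≥0∞) : EReal)

/-- The Wasserstein distance with transportation cost `‖ξ₁ - ξ₂‖_q`. If both marginals are
concentrated on a set `Ξ`, then every joint distribution is concentrated on `Ξ × Ξ`. -/
def wassersteinDist {n : ℕ} (q : ℝ≥0∞) (Q₁ Q₂ : MeasureTheory.Measure (Fin n → ℝ)) : ℝ≥0∞ :=
  ⨅ (π : MeasureTheory.Measure ((Fin n → ℝ) × (Fin n → ℝ)))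
    (_ : π.map Prod.fst = Q₁ ∧ π.map Prod.snd = Q₂),
    ∫⁻ z, ENNReal.ofReal (qNorm q (z.1 - z.2)) ∂π

/-- The Wasserstein ball of radius `ε` around `P`: all probability distributions supported
on `Ξ` whose Wasserstein distance from `P` is at most `ε`. -/
def wassersteinBall {n : ℕ} (q : ℝ≥0∞) (Ξ : Set (Fin n → ℝ)) (ε : ℝ)
    (P : MeasureTheory.Measure (Fin n → ℝ)) : Set (MeasureTheory.Measure (Fin n → ℝ)) :=
  {Q | MeasureTheory.IsProbabilityMeasure Q ∧ Q Ξᶜ = 0 ∧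
    wassersteinDist q P Q ≤ ENNReal.ofReal ε}

/-- The discrete ambiguity set: all distributions `(1 / N) ∑ i, δ_{ξ i}` with `ξ i ∈ Ξ` and
`∑ i, ‖ξ i - ξhat i‖_q ≤ N ε`. -/
def discreteBall {n N : ℕ} (q : ℝ≥0∞) (Ξ : Set (Fin n → ℝ)) (ε : ℝ)
    (ξhat : Fin N → Fin n → ℝ) : Set (MeasureTheory.Measure (Fin n → ℝ)) :=
  {P | ∃ ξ : Fin N → Fin n → ℝ, (∀ i, ξ i ∈ Ξ) ∧
    ∑ i, qNorm q (ξ i - ξhat i) ≤ N * ε ∧ P = empirical ξ}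

/-- The worst-case Conditional Value at Risk of `x` over the ambiguity set `𝒟`. -/
def worstCVaR {n : ℕ} (α : ℝ) (𝒟 : Set (MeasureTheory.Measure (Fin n → ℝ)))
    (x : Fin n → ℝ) : EReal :=
  ⨆ P ∈ 𝒟, cvar α P x

/-- `P` is a worst probability distribution for `x` in the ambiguity set `𝒟`. -/
def IsWorst {n : ℕ} (α : ℝ) (𝒟 : Set (MeasureTheory.Measure (Fin n → ℝ)))
    (x : Fin n → ℝ) (P : MeasureTheory.Measure (Fin n → ℝ)) : Prop :=
  P ∈ 𝒟 ∧ cvar α P x = worstCVaR α 𝒟 x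

/-- The coefficient `γ`: it is `N` if `α < 1 / N` and `1 / α` otherwise. -/
def gammaCoeff (N : ℕ) (α : ℝ) : ℝ := if α < 1 / (N : ℝ) then (N : ℝ) else 1 / α

/-- The regularized objective `CVaR^α_{P̂}[ξᵀ x] + γ ε ‖x‖_{q'}`. -/
def regularized {n N : ℕ} (q' : ℝ≥0∞) (α ε : ℝ) (ξhat : Fin N → Fin n → ℝ)
    (x : Fin n → ℝ) : EReal :=
  cvar α (empirical ξhat) x + ((gammaCoeff N α * ε * qNorm q' x : ℝ) : EReal)

/-- The problems `min {f x : x ∈ X}` and `min {g x : x ∈ X}` are the same: equal objective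
values on `X`, equal optimal values, and the same optimal solutions. -/
def SameProblem {V : Type*} (X : Set V) (f g : V → EReal) : Prop :=
  (∀ x ∈ X, f x = g x) ∧ (⨅ x ∈ X, f x) = (⨅ x ∈ X, g x) ∧
    ∀ x ∈ X, IsMinOn f X x ↔ IsMinOn g X x

end WRobust

end

/-! Upper bound. For fixed `t`, the map `ξ ↦ [ξᵀx - t]₊` is `‖x‖_{q'}`-Lipschitz by Hölder, so
transport of cost `ε` raises the objective by at most `ε‖x‖_{q'}/α`
(`lintegral_le_add_of_coupling`). If `α < 1/N` this is too weak; there CVaR of an empirical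
distribution is its largest scenario, and the budget moves no scenario by more than `Nε`, so the
maximum rises by at most `Nε‖x‖_{q'}`.

Lower bound. Spend the whole budget `Nε` on the largest scenario, along a direction dual to `x`
(`exists_dual_direction`). As `x` is binary, a multiple of `x` serves; it is nonnegative, so the
orthant is not left. `exists_scenarioObjective_add_le` computes the gain. This distribution also
lies in the Wasserstein ball, so it is worst there too when `α ≥ 1/N`. -/

namespace WRobust

open MeasureTheory

/-! ### Hölder duality and dual directions of binary vectors -/

section Norm

variable {n : ℕ} {q q' : ℝ≥0∞}

theorem qNorm_nonneg [Fact (1 ≤ q)] (v : Fin n → ℝ) : 0 ≤ qNorm q v := norm_nonneg _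

theorem qNorm_smul [Fact (1 ≤ q)] (c : ℝ) (v : Fin n → ℝ) :
    qNorm q (c • v) = |c| * qNorm q v := by
  unfold qNorm
  rw [WithLp.toLp_smul, norm_smul, Real.norm_eq_abs]

theorem qNorm_sub_comm [Fact (1 ≤ q)] (u v : Fin n → ℝ) :
    qNorm q (u - v) = qNorm q (v - u) := by
  unfold qNorm
  rw [WithLp.toLp_sub, WithLp.toLp_sub, norm_sub_rev]

@[simp]
theorem qNorm_zero [Fact (1 ≤ q)] : qNorm q (0 : Fin n → ℝ) = 0 := by
  unfold qNorm
  rw [WithLp.toLp_zero, norm_zero]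

theorem abs_le_qNorm [Fact (1 ≤ q)] (v : Fin n → ℝ) (i : Fin n) : |v i| ≤ qNorm q v :=
  PiLp.norm_apply_le (WithLp.toLp q v : PiLp q (fun _ : Fin n => ℝ)) i

theorem qNorm_one (v : Fin n → ℝ) : qNorm 1 v = ∑ i, |v i| := by
  unfold qNorm
  rw [PiLp.norm_eq_of_L1]
  rfl

theorem qNorm_eq_sum (h : 0 < q.toReal) (v : Fin n → ℝ) :
    qNorm q v = (∑ i, |v i| ^ q.toReal) ^ (1 / q.toReal) :=
  PiLp.norm_eq_sum h _

theorem dotProduct_le_sum_abs_mul_qNorm_top (u v : Fin n → ℝ) :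
    u ⬝ᵥ v ≤ qNorm 1 u * qNorm ⊤ v := by
  rw [qNorm_one, Finset.sum_mul]
  refine Finset.sum_le_sum fun i _ => (le_abs_self _).trans ?_
  rw [abs_mul]
  exact mul_le_mul_of_nonneg_left (abs_le_qNorm v i) (abs_nonneg _)

/-- Hölder's inequality for conjugate exponents in `[1, ∞]`. -/
theorem dotProduct_le_qNorm_mul_qNorm (h : q.HolderConjugate q') (u v : Fin n → ℝ) :
    u ⬝ᵥ v ≤ qNorm q u * qNorm q' v := by
  have h1 := ENNReal.HolderConjugate.inv_add_inv_eq_one q q'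
  by_cases hq : q = ⊤
  · subst hq
    obtain rfl : q' = 1 := by simpa using h1
    rw [dotProduct_comm, mul_comm]
    exact dotProduct_le_sum_abs_mul_qNorm_top v u
  by_cases hq' : q' = ⊤
  · subst hq'
    obtain rfl : q = 1 := by simpa using h1
    exact dotProduct_le_sum_abs_mul_qNorm_top u v
  have hr := ENNReal.HolderConjugate.toReal_of_ne_top hq hq'
  rw [qNorm_eq_sum hr.pos, qNorm_eq_sum hr.symm.pos]
  exact Real.inner_le_Lp_mul_Lq _ _ _ hr

theorem one_le_dotProduct_self_of_binary {x : Fin n → ℝ} (hx : ∀ j, x j = 0 ∨ x j = 1)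
    (h0 : x ≠ 0) : 1 ≤ x ⬝ᵥ x := by
  obtain ⟨j, hj⟩ := Function.ne_iff.1 h0
  have hj1 : x j = 1 := (hx j).resolve_left hj
  calc (1 : ℝ) = x j * x j := by rw [hj1, one_mul]
    _ ≤ x ⬝ᵥ x := Finset.single_le_sum (f := fun i => x i * x i)
        (fun i _ => mul_self_nonneg (x i)) (Finset.mem_univ j)

/-- The `q`-norm of a nonzero binary vector with `k` ones is `k ^ (1 / q)`. -/
theorem qNorm_of_binary [hq : Fact (1 ≤ q)] {x : Fin n → ℝ} (hx : ∀ j, x j = 0 ∨ x j = 1)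
    (h0 : x ≠ 0) : qNorm q x = (x ⬝ᵥ x) ^ (1 / q).toReal := by
  by_cases hqt : q = ⊤
  · subst hqt
    obtain ⟨j, hj⟩ := Function.ne_iff.1 h0
    have hj1 : x j = 1 := (hx j).resolve_left hj
    have hle : qNorm ⊤ x ≤ 1 := by
      unfold qNorm
      rw [PiLp.norm_toLp]
      refine (pi_norm_le_iff_of_nonneg zero_le_one).2 fun i => ?_
      rcases hx i with h | h <;> simp [h]
    have hge := abs_le_qNorm (q := ⊤) x j
    rw [hj1, abs_one] at hge
    simpa using le_antisymm hle hge
  · have hpos : 0 < q.toReal :=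
      ENNReal.toReal_pos (zero_lt_one.trans_le hq.out).ne' hqt
    rw [qNorm_eq_sum hpos, ENNReal.toReal_div, ENNReal.toReal_one]
    congr 1
    refine Finset.sum_congr rfl fun i _ => ?_
    rcases hx i with h | h <;> simp [h, hpos.ne']

/-- A nonnegative direction of `q`-norm at most one attaining the dual norm of a binary vector. -/
theorem exists_dual_direction [Fact (1 ≤ q)] [Fact (1 ≤ q')] (h : 1 / q + 1 / q' = 1)
    {x : Fin n → ℝ} (hx : ∀ j, x j = 0 ∨ x j = 1) :
    ∃ d ∈ orthant n, qNorm q d ≤ 1 ∧ d ⬝ᵥ x = qNorm q' x := by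
  by_cases h0 : x = 0
  · subst h0
    exact ⟨0, fun _ => le_rfl, by simp, by simp⟩
  have hk := one_le_dotProduct_self_of_binary hx h0
  have hk0 : 0 < x ⬝ᵥ x := zero_lt_one.trans_le hk
  have hsum : (1 / q).toReal + (1 / q').toReal = 1 := by
    rw [← ENNReal.toReal_add _ _, h, ENNReal.toReal_one]
    · exact ne_top_of_le_ne_top ENNReal.one_ne_top (le_self_add.trans h.le)
    · exact ne_top_of_le_ne_top ENNReal.one_ne_top (le_add_self.trans h.le)
  -- This is `x` normalized: with `k = x ⬝ᵥ x` ones, `‖x‖_q = k^(1/q)`, and pairing with `x` gives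
  -- `k^(1 - 1/q) = k^(1/q')`.
  refine ⟨(x ⬝ᵥ x) ^ (-(1 / q).toReal) • x, fun j => ?_, ?_, ?_⟩
  · refine mul_nonneg (Real.rpow_nonneg hk0.le _) ?_
    rcases hx j with h | h <;> simp [h]
  · rw [qNorm_smul, abs_of_nonneg (Real.rpow_nonneg hk0.le _), qNorm_of_binary hx h0,
      ← Real.rpow_add hk0, neg_add_cancel, Real.rpow_zero]
  · rw [smul_dotProduct, smul_eq_mul, qNorm_of_binary hx h0]
    nth_rewrite 2 [← Real.rpow_one (x ⬝ᵥ x)]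
    rw [← Real.rpow_add hk0]
    congr 1
    linarith

end Norm

/-! ### CVaR of finitely many equally likely scenarios -/

section Scenario

variable {N : ℕ}

/-- The objective `t + (1 / α) E[a - t]₊` for `a` uniformly distributed over `N` scenarios. -/
noncomputable def scenarioObjective (α : ℝ) (a : Fin N → ℝ) (t : ℝ) : ℝ :=
  t + 1 / α * ((N : ℝ)⁻¹ * ∑ i, max 0 (a i - t))

theorem lintegral_empirical {n : ℕ} (ξ : Fin N → Fin n → ℝ) (f : (Fin n → ℝ) → ℝ≥0∞) :
    ∫⁻ z, f z ∂(empirical ξ) = (N : ℝ≥0∞)⁻¹ * ∑ i, f (ξ i) := by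
  simp [empirical, lintegral_finsetSum_measure]

theorem cvar_empirical {n : ℕ} (hN : 1 ≤ N) {α : ℝ} (hα : 0 < α) (ξ : Fin N → Fin n → ℝ)
    (x : Fin n → ℝ) :
    cvar α (empirical ξ) x =
      ⨅ t : ℝ, (scenarioObjective α (fun i => ξ i ⬝ᵥ x) t : EReal) := by
  unfold cvar
  refine iInf_congr fun t => ?_
  have hN0 : (0 : ℝ) < N := by exact_mod_cast hN
  have hs : 0 ≤ ∑ i, max 0 (ξ i ⬝ᵥ x - t) := Finset.sum_nonneg fun i _ => le_max_left _ _
  rw [lintegral_empirical, ← ENNReal.ofReal_sum_of_nonneg (fun i _ => le_max_left _ _),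
    ← ENNReal.ofReal_natCast, ← ENNReal.ofReal_inv_of_pos hN0,
    ← ENNReal.ofReal_mul (by positivity), ← ENNReal.ofReal_mul (by positivity),
    EReal.coe_ennreal_ofReal, max_eq_left (by positivity), scenarioObjective, EReal.coe_add]

theorem regularized_eq_iInf {n : ℕ} (hN : 1 ≤ N) (q' : ℝ≥0∞) {α : ℝ} (hα : 0 < α) (ε : ℝ)
    (ξ : Fin N → Fin n → ℝ) (x : Fin n → ℝ) :
    regularized q' α ε ξ x =
      ⨅ t : ℝ, ((scenarioObjective α (fun i => ξ i ⬝ᵥ x) t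
        + gammaCoeff N α * ε * qNorm q' x : ℝ) : EReal) := by
  unfold regularized
  rw [cvar_empirical hN hα]
  refine le_antisymm (le_iInf fun t => ?_) ?_
  · rw [EReal.coe_add]
    exact add_le_add (iInf_le _ t) le_rfl
  · rw [← EReal.sub_le_iff_le_add (.inl (EReal.coe_ne_bot _)) (.inl (EReal.coe_ne_top _))]
    refine le_iInf fun t => ?_
    rw [EReal.sub_le_iff_le_add (.inl (EReal.coe_ne_bot _)) (.inl (EReal.coe_ne_top _)),
      ← EReal.coe_add]
    exact iInf_le _ t

theorem single_le_scenarioObjective {α : ℝ} (hα : 0 < α) (a : Fin N → ℝ) (t : ℝ) (i : Fin N) :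
    t + 1 / α * ((N : ℝ)⁻¹ * max 0 (a i - t)) ≤ scenarioObjective α a t := by
  have h := Finset.single_le_sum (f := fun i => max 0 (a i - t))
    (fun i _ => le_max_left _ _) (Finset.mem_univ i)
  unfold scenarioObjective
  gcongr

/-- For `α ≤ 1/N` a single scenario carries weight at least one, so its excess over `t` alone makes
up for a low `t`. -/
theorem le_scenarioObjective {α : ℝ} (hα : 0 < α) (hα1 : 1 ≤ 1 / α * (N : ℝ)⁻¹)
    (a : Fin N → ℝ) (t : ℝ) (i : Fin N) : a i ≤ scenarioObjective α a t := by
  refine le_trans ?_ (single_le_scenarioObjective hα a t i)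
  have h0 : 0 ≤ max 0 (a i - t) := le_max_left _ _
  have h1 : a i - t ≤ max 0 (a i - t) := le_max_right _ _
  have h2 := le_mul_of_one_le_left h0 hα1
  linarith

theorem scenarioObjective_of_le {α : ℝ} {a : Fin N → ℝ} {t : ℝ} (h : ∀ i, a i ≤ t) :
    scenarioObjective α a t = t := by
  simp [scenarioObjective, Finset.sum_eq_zero fun i _ => max_eq_left (sub_nonpos.2 (h i))]

/-- Raising the largest scenario by `N r` raises the Conditional Value at Risk by at
least `γ r`. -/
theorem exists_scenarioObjective_add_le (hN : 1 ≤ N) {α : ℝ} (hα : 0 < α) {r : ℝ} (hr : 0 ≤ r)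
    {a b : Fin N → ℝ} {m : Fin N} (ham : ∀ i, a i ≤ a m) (hbm : b m = a m + N * r)
    (hb : ∀ i, i ≠ m → b i = a i) (t : ℝ) :
    ∃ s, scenarioObjective α a s + gammaCoeff N α * r ≤ scenarioObjective α b t := by
  have hN0 : (0 : ℝ) < N := by exact_mod_cast hN
  have hNr : 0 ≤ (N : ℝ) * r := by positivity
  have hc : 1 / α * (N : ℝ)⁻¹ * (N * r) = 1 / α * r := by field_simp
  by_cases h : α < 1 / N
  · refine ⟨a m, ?_⟩
    have h1 : 1 ≤ 1 / α * (N : ℝ)⁻¹ := by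
      rw [lt_div_iff₀ hN0] at h
      rw [one_div, ← mul_inv]
      exact (one_le_inv₀ (by positivity)).2 h.le
    rw [gammaCoeff, if_pos h, scenarioObjective_of_le ham, ← hbm]
    exact le_scenarioObjective hα h1 b t m
  · rw [gammaCoeff, if_neg h]
    have h1 : 1 / α * (N : ℝ)⁻¹ ≤ 1 := by
      rw [not_lt, div_le_iff₀ hN0] at h
      rw [one_div, ← mul_inv]
      exact inv_le_one_of_one_le₀ h
    have h0 : 0 ≤ 1 / α * (N : ℝ)⁻¹ := by positivity
    rcases le_total t (a m) with ht | ht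
    -- Scenario `m` exceeds `t` before and after the raise, so its term grows by exactly `N * r`.
    · refine ⟨t, le_of_eq ?_⟩
      have hs : ∑ i, max 0 (b i - t) = ∑ i, max 0 (a i - t) + N * r := by
        rw [← Finset.add_sum_erase _ _ (Finset.mem_univ m),
          ← Finset.add_sum_erase _ (fun i => max 0 (a i - t)) (Finset.mem_univ m),
          Finset.sum_congr rfl fun i hi => by rw [hb i (Finset.ne_of_mem_erase hi)], hbm,
          max_eq_right (sub_nonneg.2 ht), max_eq_right (by linarith)]
        ring
      rw [scenarioObjective, scenarioObjective, hs]
      linear_combination -hc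
    -- Here part of the raise may stay below `t`; comparing with `s = a m` instead gains `t - a m`,
    -- which covers the loss because the scenario weight is at most one.
    · refine ⟨a m, ?_⟩
      rw [scenarioObjective_of_le ham]
      refine le_trans ?_ (single_le_scenarioObjective hα b t m)
      have h2 : (b m - t) ≤ max 0 (b m - t) := le_max_right _ _
      have h3 := mul_le_mul_of_nonneg_left h2 h0
      have h4 := mul_le_of_le_one_left (sub_nonneg.2 ht) h1
      rw [← hc]
      rw [hbm] at h3 ⊢
      linarith

end Scenario

/-! ### Upper bounds on both balls and the worst distribution -/

section Bounds

variable {n N : ℕ} {q q' : ℝ≥0∞}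

/-- For `α < 1 / N` the regularized objective dominates the Conditional Value at Risk on the
discrete ambiguity set. -/
theorem cvar_le_regularized_of_mem_discreteBall [Fact (1 ≤ q)] [Fact (1 ≤ q')]
    (hq : q.HolderConjugate q') (hN : 1 ≤ N) {α : ℝ} (hα : 0 < α) (hαN : α < 1 / N) {ε : ℝ}
    {ξhat : Fin N → Fin n → ℝ} {Ξ : Set (Fin n → ℝ)} {P : Measure (Fin n → ℝ)}
    (hP : P ∈ discreteBall q Ξ ε ξhat) (x : Fin n → ℝ) :
    cvar α P x ≤ regularized q' α ε ξhat x := by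
  obtain ⟨ξ, -, hcost, rfl⟩ := hP
  have hN0 : (0 : ℝ) < N := by exact_mod_cast hN
  have : Nonempty (Fin N) := ⟨⟨0, hN⟩⟩
  obtain ⟨m, hm⟩ := Finite.exists_max fun i => ξhat i ⬝ᵥ x
  rw [regularized_eq_iInf hN q' hα, cvar_empirical hN hα]
  -- This level lies above every perturbed scenario, so all positive parts vanish.
  refine le_iInf fun t => (iInf_le _ (ξhat m ⬝ᵥ x + N * ε * qNorm q' x)).trans ?_
  rw [EReal.coe_le_coe_iff, scenarioObjective_of_le, gammaCoeff, if_pos hαN]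
  · have h1 : 1 ≤ 1 / α * (N : ℝ)⁻¹ := by
      rw [lt_div_iff₀ hN0] at hαN
      rw [one_div, ← mul_inv]
      exact (one_le_inv₀ (by positivity)).2 hαN.le
    have := le_scenarioObjective hα h1 (fun i => ξhat i ⬝ᵥ x) t m
    gcongr
  · intro i
    have h1 : (ξ i - ξhat i) ⬝ᵥ x ≤ qNorm q (ξ i - ξhat i) * qNorm q' x :=
      dotProduct_le_qNorm_mul_qNorm hq _ _
    have h2 : qNorm q (ξ i - ξhat i) ≤ N * ε :=
      (Finset.single_le_sum (f := fun i => qNorm q (ξ i - ξhat i))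
        (fun i _ => qNorm_nonneg _) (Finset.mem_univ i)).trans hcost
    have h3 := mul_le_mul_of_nonneg_right h2 (qNorm_nonneg (q := q') x)
    rw [sub_dotProduct] at h1
    have := hm i
    linarith

theorem measurable_max_zero_dotProduct_sub (x : Fin n → ℝ) (t : ℝ) :
    Measurable fun ξ : Fin n → ℝ => ENNReal.ofReal (max 0 (ξ ⬝ᵥ x - t)) := by
  refine ENNReal.measurable_ofReal.comp (Continuous.measurable ?_)
  unfold dotProduct
  fun_prop

theorem lintegral_le_add_of_coupling [Fact (1 ≤ q)] [Fact (1 ≤ q')]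
    (hq : q.HolderConjugate q') (x : Fin n → ℝ) (t : ℝ)
    (π : Measure ((Fin n → ℝ) × (Fin n → ℝ))) :
    ∫⁻ ξ, ENNReal.ofReal (max 0 (ξ ⬝ᵥ x - t)) ∂(π.map Prod.snd) ≤
      ∫⁻ ξ, ENNReal.ofReal (max 0 (ξ ⬝ᵥ x - t)) ∂(π.map Prod.fst) +
        ENNReal.ofReal (qNorm q' x) * ∫⁻ z, ENNReal.ofReal (qNorm q (z.1 - z.2)) ∂π := by
  have hmeas := measurable_max_zero_dotProduct_sub x t
  rw [lintegral_map hmeas measurable_snd, lintegral_map hmeas measurable_fst,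
    ← lintegral_const_mul' _ _ ENNReal.ofReal_ne_top,
    ← lintegral_add_left (by exact hmeas.comp measurable_fst)]
  refine lintegral_mono fun z => ?_
  have h0 : 0 ≤ qNorm q' x := qNorm_nonneg x
  have h1 : 0 ≤ qNorm q (z.1 - z.2) := qNorm_nonneg _
  have h2 := dotProduct_le_qNorm_mul_qNorm hq (z.2 - z.1) x
  rw [sub_dotProduct, qNorm_sub_comm, mul_comm] at h2
  dsimp only [Function.comp_apply]
  rw [← ENNReal.ofReal_mul h0, ← ENNReal.ofReal_add (le_max_left _ _) (by positivity)]
  refine ENNReal.ofReal_le_ofReal (max_le (by positivity) ?_)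
  have := le_max_right 0 (z.1 ⬝ᵥ x - t)
  linarith

theorem lintegral_le_add_wassersteinDist [Fact (1 ≤ q)] [Fact (1 ≤ q')]
    (hq : q.HolderConjugate q') (x : Fin n → ℝ) (t : ℝ) {P Q : Measure (Fin n → ℝ)} {ε : ℝ≥0∞}
    (hε : ε ≠ ⊤) (hPQ : wassersteinDist q P Q ≤ ε) :
    ∫⁻ ξ, ENNReal.ofReal (max 0 (ξ ⬝ᵥ x - t)) ∂Q ≤
      ∫⁻ ξ, ENNReal.ofReal (max 0 (ξ ⬝ᵥ x - t)) ∂P + ENNReal.ofReal (qNorm q' x) * ε := by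
  -- No optimal coupling is assumed: a coupling of cost below `c` exists for each `c > ε`, and then
  -- `c` decreases to `ε`.
  have key : ∀ c, ε < c → ∫⁻ ξ, ENNReal.ofReal (max 0 (ξ ⬝ᵥ x - t)) ∂Q ≤
      ∫⁻ ξ, ENNReal.ofReal (max 0 (ξ ⬝ᵥ x - t)) ∂P + ENNReal.ofReal (qNorm q' x) * c := by
    intro c hc
    have hlt := hPQ.trans_lt hc
    simp only [wassersteinDist, iInf_lt_iff] at hlt
    obtain ⟨π, ⟨rfl, rfl⟩, hπ⟩ := hlt
    refine (lintegral_le_add_of_coupling hq x t π).trans ?_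
    gcongr
  have : (nhdsWithin ε (Set.Ioi ε)).NeBot := nhdsGT_neBot_of_exists_gt ⟨⊤, hε.lt_top⟩
  have hlim : Filter.Tendsto (fun c => ∫⁻ ξ, ENNReal.ofReal (max 0 (ξ ⬝ᵥ x - t)) ∂P +
      ENNReal.ofReal (qNorm q' x) * c) (nhdsWithin ε (Set.Ioi ε))
      (nhds (∫⁻ ξ, ENNReal.ofReal (max 0 (ξ ⬝ᵥ x - t)) ∂P + ENNReal.ofReal (qNorm q' x) * ε)) :=
    (((ENNReal.continuous_const_mul ENNReal.ofReal_ne_top).const_add _).tendsto ε).mono_left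
      nhdsWithin_le_nhds
  exact ge_of_tendsto hlim (Filter.eventually_of_mem self_mem_nhdsWithin key)

/-- For `1 / N ≤ α` the regularized objective dominates the Conditional Value at Risk on the
Wasserstein ball. -/
theorem cvar_le_regularized_of_mem_wassersteinBall [Fact (1 ≤ q)] [Fact (1 ≤ q')]
    (hq : q.HolderConjugate q') {α : ℝ} (hα : 0 < α)
    (hαN : 1 / (N : ℝ) ≤ α) {ε : ℝ} (hε : 0 ≤ ε) {ξhat : Fin N → Fin n → ℝ}
    {Ξ : Set (Fin n → ℝ)} {Q : Measure (Fin n → ℝ)}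
    (hQ : Q ∈ wassersteinBall q Ξ ε (empirical ξhat)) (x : Fin n → ℝ) :
    cvar α Q x ≤ regularized q' α ε ξhat x := by
  have h0 : 0 ≤ qNorm q' x := qNorm_nonneg x
  unfold regularized
  rw [← EReal.sub_le_iff_le_add (.inl (EReal.coe_ne_bot _)) (.inl (EReal.coe_ne_top _))]
  refine le_iInf fun t => ?_
  rw [EReal.sub_le_iff_le_add (.inl (EReal.coe_ne_bot _)) (.inl (EReal.coe_ne_top _))]
  refine (iInf_le _ t).trans ?_
  rw [add_assoc]
  refine add_le_add le_rfl ?_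
  have hr : ((gammaCoeff N α * ε * qNorm q' x : ℝ) : EReal) =
      ((ENNReal.ofReal (1 / α) * (ENNReal.ofReal (qNorm q' x) * ENNReal.ofReal ε) : ℝ≥0∞) :
        EReal) := by
    rw [← ENNReal.ofReal_mul h0, ← ENNReal.ofReal_mul (by positivity), EReal.coe_ennreal_ofReal,
      max_eq_left (by positivity), gammaCoeff, if_neg hαN.not_gt, mul_assoc, mul_comm ε]
  rw [hr, ← EReal.coe_ennreal_add, EReal.coe_ennreal_le_coe_ennreal_iff, ← mul_add]
  gcongr
  exact lintegral_le_add_wassersteinDist hq x t ENNReal.ofReal_ne_top hQ.2.2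

theorem measurableSet_orthant : MeasurableSet (orthant n) := by
  have : orthant n = Set.Ici 0 := rfl
  rw [this]
  exact measurableSet_Ici

theorem map_uniform_sum_dirac {Z : Type*} [MeasurableSpace Z] {f : Z → Fin n → ℝ}
    (hf : Measurable f) (z : Fin N → Z) :
    ((N : ℝ≥0∞)⁻¹ • ∑ i, Measure.dirac (z i)).map f = empirical (fun i => f (z i)) := by
  rw [empirical, Measure.map_smul, ← Measure.mapₗ_apply_of_measurable hf, map_sum]
  simp only [Measure.mapₗ_apply_of_measurable hf, Measure.map_dirac' hf]

theorem discreteBall_subset_wassersteinBall [Fact (1 ≤ q)] (hN : 1 ≤ N) {ε : ℝ}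
    (ξhat : Fin N → Fin n → ℝ) :
    discreteBall q (orthant n) ε ξhat ⊆ wassersteinBall q (orthant n) ε (empirical ξhat) := by
  rintro _ ⟨ξ, hξ, hcost, rfl⟩
  have hN0 : (0 : ℝ) < N := by exact_mod_cast hN
  have hNe : (N : ℝ≥0∞) ≠ 0 := by exact_mod_cast (zero_lt_one.trans_le hN).ne'
  refine ⟨⟨?_⟩, ?_, ?_⟩
  · simp [empirical, ENNReal.inv_mul_cancel hNe]
  · simp [empirical, Measure.dirac_apply' _ measurableSet_orthant.compl, hξ]
  · unfold wassersteinDist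
    -- The coupling moves each `ξhat i` to `ξ i`.
    refine iInf₂_le_of_le ((N : ℝ≥0∞)⁻¹ • ∑ i, Measure.dirac (ξhat i, ξ i))
      ⟨map_uniform_sum_dirac measurable_fst fun i => (ξhat i, ξ i),
        map_uniform_sum_dirac measurable_snd fun i => (ξhat i, ξ i)⟩ ?_
    simp only [lintegral_smul_measure, lintegral_finsetSum_measure, lintegral_dirac, smul_eq_mul]
    rw [← ENNReal.ofReal_sum_of_nonneg (fun i _ => qNorm_nonneg _), ← ENNReal.ofReal_natCast,
      ← ENNReal.ofReal_inv_of_pos hN0, ← ENNReal.ofReal_mul (by positivity)]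
    refine ENNReal.ofReal_le_ofReal ?_
    rw [inv_mul_le_iff₀ hN0]
    simpa only [qNorm_sub_comm] using hcost

/-- Some distribution in the discrete ambiguity set has a Conditional Value at Risk of at least
the regularized objective. -/
theorem exists_mem_discreteBall_regularized_le [Fact (1 ≤ q)] [Fact (1 ≤ q')]
    (h : 1 / q + 1 / q' = 1) (hN : 1 ≤ N) {α : ℝ} (hα : 0 < α) {ε : ℝ} (hε : 0 ≤ ε)
    {ξhat : Fin N → Fin n → ℝ} (hξhat : ∀ i, ξhat i ∈ orthant n) {x : Fin n → ℝ}
    (hx : ∀ j, x j = 0 ∨ x j = 1) :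
    ∃ P ∈ discreteBall q (orthant n) ε ξhat, regularized q' α ε ξhat x ≤ cvar α P x := by
  have hN0 : (0 : ℝ) < N := by exact_mod_cast hN
  have hNε : 0 ≤ (N : ℝ) * ε := by positivity
  have : Nonempty (Fin N) := ⟨⟨0, hN⟩⟩
  obtain ⟨m, hm⟩ := Finite.exists_max fun i => ξhat i ⬝ᵥ x
  obtain ⟨d, hd, hd1, hdx⟩ := exists_dual_direction h hx
  refine ⟨empirical (ξhat + Pi.single m ((N * ε) • d)), ⟨_, fun i => ?_, ?_, rfl⟩, ?_⟩
  · by_cases hi : i = m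
    · subst hi
      intro j
      simpa using add_nonneg (hξhat i j) (mul_nonneg hNε (hd j))
    · simpa [hi] using hξhat i
  · rw [Finset.sum_eq_single m (fun i _ hi => by simp [hi]) (by simp)]
    simp only [Pi.add_apply, Pi.single_eq_same, add_sub_cancel_left]
    rw [qNorm_smul, abs_of_nonneg hNε]
    exact mul_le_of_le_one_right hNε hd1
  · rw [regularized_eq_iInf hN q' hα, cvar_empirical hN hα]
    refine le_iInf fun t => ?_
    obtain ⟨s, hs⟩ := exists_scenarioObjective_add_le hN hα
      (mul_nonneg hε (qNorm_nonneg (q := q') x)) hm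
      (b := fun i => (ξhat + Pi.single m ((N * ε) • d) : Fin N → Fin n → ℝ) i ⬝ᵥ x)
      (by simp [add_dotProduct, smul_dotProduct, hdx, mul_assoc])
      (fun i hi => by simp [hi]) t
    refine (iInf_le _ s).trans ?_
    rw [EReal.coe_le_coe_iff, mul_assoc]
    exact hs

end Bounds

/-! ### From matching bounds to equivalent problems -/

theorem worst_of_bounds {n : ℕ} {α : ℝ} {𝒟 : Set (Measure (Fin n → ℝ))} {X : Set (Fin n → ℝ)}
    {g : (Fin n → ℝ) → EReal} (hub : ∀ x ∈ X, ∀ P ∈ 𝒟, cvar α P x ≤ g x)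
    (hlb : ∀ x ∈ X, ∃ P ∈ 𝒟, g x ≤ cvar α P x) :
    (∀ x ∈ X, ∃ P, IsWorst α 𝒟 x P) ∧ SameProblem X (worstCVaR α 𝒟) g := by
  have hle : ∀ x ∈ X, worstCVaR α 𝒟 x ≤ g x := fun x hx => iSup₂_le (hub x hx)
  have heq : ∀ x ∈ X, worstCVaR α 𝒟 x = g x := fun x hx => by
    obtain ⟨P, hP, h⟩ := hlb x hx
    exact (hle x hx).antisymm (h.trans (le_iSup₂ (f := fun P _ => cvar α P x) P hP))
  refine ⟨fun x hx => ?_, heq, iInf_congr fun x => iInf_congr (heq x), fun x hx => ?_⟩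
  · obtain ⟨P, hP, h⟩ := hlb x hx
    exact ⟨P, hP, (le_iSup₂ (f := fun P _ => cvar α P x) P hP).antisymm ((hle x hx).trans h)⟩
  · simp only [isMinOn_iff, heq x hx]
    exact forall₂_congr fun y hy => by rw [heq y hy]

end WRobust

theorem mainTheorem1 {n N : ℕ} (hN : 1 ≤ N)
    (q q' : ℝ≥0∞) (hq : 1 ≤ q) (hq' : 1 / q + 1 / q' = 1)
    (α : ℝ) (hα0 : 0 < α) (hα1 : α ≤ 1) (ε : ℝ) (hε : 0 ≤ ε)
    (ξhat : Fin N → Fin n → ℝ) (hξhat : ∀ i, ξhat i ∈ WRobust.orthant n)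
    (X : Set (Fin n → ℝ)) (hX : ∀ x ∈ X, ∀ j, x j = 0 ∨ x j = 1) :
    ((∀ x ∈ X, ∃ P, WRobust.IsWorst α
        (WRobust.discreteBall q (WRobust.orthant n) ε ξhat) x P) ∧
      WRobust.SameProblem X
        (WRobust.worstCVaR α (WRobust.discreteBall q (WRobust.orthant n) ε ξhat))
        (WRobust.regularized q' α ε ξhat)) ∧
    (1 / (N : ℝ) ≤ α →
      (∀ x ∈ X, ∃ P, WRobust.IsWorst α
        (WRobust.wassersteinBall q (WRobust.orthant n) ε (WRobust.empirical ξhat)) x P) ∧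
      WRobust.SameProblem X
        (WRobust.worstCVaR α
          (WRobust.wassersteinBall q (WRobust.orthant n) ε (WRobust.empirical ξhat)))
        (WRobust.regularized q' α ε ξhat)) := by
  have : Fact (1 ≤ q) := ⟨hq⟩
  have hc : q.HolderConjugate q' := ENNReal.holderConjugate_iff.2 (by simpa using hq')
  have : Fact (1 ≤ q') := ⟨by
    rw [← ENNReal.inv_le_one, ← one_div]
    exact le_add_self.trans hq'.le⟩
  have hlb : ∀ x ∈ X, ∃ P ∈ WRobust.discreteBall q (WRobust.orthant n) ε ξhat,
      WRobust.regularized q' α ε ξhat x ≤ WRobust.cvar α P x := fun x hx =>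
    WRobust.exists_mem_discreteBall_regularized_le hq' hN hα0 hε hξhat (hX x hx)
  have hsub := WRobust.discreteBall_subset_wassersteinBall (q := q) (ε := ε) hN ξhat
  refine ⟨WRobust.worst_of_bounds (fun x _ P hP => ?_) hlb, fun hαN =>
    WRobust.worst_of_bounds (fun x _ Q hQ =>
      WRobust.cvar_le_regularized_of_mem_wassersteinBall hc hα0 hαN hε hQ x) fun x hx => ?_⟩
  · rcases lt_or_ge α (1 / N) with h | h
    · exact WRobust.cvar_le_regularized_of_mem_discreteBall hc hN hα0 h hP x
    · exact WRobust.cvar_le_regularized_of_mem_wassersteinBall hc hα0 h hε (hsub hP) x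
  · obtain ⟨P, hP, h⟩ := hlb x hx
    exact ⟨P, hsub hP, h⟩
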